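/- Let $\Bbbk$ be an algebraically closed field with $\operatorname{char}\Bbbk\neq 2$, let $n\ge 0$, and let $X,Y\subset\mathbb{A}^n=\Bbbk^n$ be affine varieties, i.e. common zero sets of polynomials (not necessarily irreducible). Let $\overline{X},\overline{Y}\subset\mathbb{P}^n$ be their projective closures, i.e. the Zariski closures of their images under $(x_1,\dots,x_n)\mapsto[1:x_1:\cdots:x_n]$, and let $H_0=\{[x_0:\cdots:x_n]\in\mathbb{P}^n \mid x_0=0\}$ be the hyperplane at infinity. Suppose that $X$ and $Y$ are disjoint at infinity, i.e. $\overline{X}\cap\overline{Y}\cap H_0=\emptyset$. Let $X+Y\subset\mathbb{A}^n$ denote the Minkowski sum, i.e. the Zariski closure of $\{x+y \mid x\in X,\ y\in Y\}$. Then $$\dim(X+Y)=\dim X+\dim Y,$$ where $\dim$ is the Krull dimension (of the coordinate ring), with $\dim\emptyset=-\infty$. -/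

import Mathlib

open scoped LinearAlgebra.Projectivization

namespace MinkowskiSum

variable {𝕜 : Type*} [Field 𝕜] {n : ℕ}

/-- A subset of affine `n`-space is an affine variety (an algebraic set, possibly reducible)
if it is the common zero set of an ideal of polynomials. -/
def IsAffineVariety (X : Set (Fin n → 𝕜)) : Prop :=
  ∃ I : Ideal (MvPolynomial (Fin n) 𝕜), X = MvPolynomial.zeroLocus 𝕜 I

/-- The Zariski closure of a subset of affine `n`-space. -/
def zariskiClosure (S : Set (Fin n → 𝕜)) : Set (Fin n → 𝕜) :=
  MvPolynomial.zeroLocus 𝕜 (MvPolynomial.vanishingIdeal 𝕜 S)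

/-- The coordinate ring `𝕜[x₁, …, xₙ] / I(X)` of `X`. -/
abbrev CoordinateRing (X : Set (Fin n → 𝕜)) : Type _ :=
  MvPolynomial (Fin n) 𝕜 ⧸ MvPolynomial.vanishingIdeal 𝕜 X

/-- The dimension of an affine variety: the Krull dimension of its coordinate ring
(`⊥` for the empty variety). -/
noncomputable def dim (X : Set (Fin n → 𝕜)) : WithBot ℕ∞ :=
  ringKrullDim (CoordinateRing X)

/-- The Minkowski sum: the Zariski closure of the image of `X × Y` under addition. -/
def minkowskiSum (X Y : Set (Fin n → 𝕜)) : Set (Fin n → 𝕜) :=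
  zariskiClosure ((fun p : (Fin n → 𝕜) × (Fin n → 𝕜) => p.1 + p.2) '' (X ×ˢ Y))

theorem cons_one_ne_zero (x : Fin n → 𝕜) : (Fin.cons 1 x : Fin (n + 1) → 𝕜) ≠ 0 := fun h =>
  one_ne_zero (α := 𝕜) (by simpa using congrFun h 0)

/-- The standard chart `(x₁, …, xₙ) ↦ [1 : x₁ : ⋯ : xₙ]`. -/
def toProjective (x : Fin n → 𝕜) : ℙ 𝕜 (Fin (n + 1) → 𝕜) :=
  Projectivization.mk 𝕜 (Fin.cons 1 x) (cons_one_ne_zero x)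

/-- The Zariski closure of a subset of projective `n`-space: the common zeros of all homogeneous
polynomials vanishing on it. Whether a homogeneous polynomial vanishes at a point does not depend
on the chosen representative. -/
def projectiveZariskiClosure (S : Set (ℙ 𝕜 (Fin (n + 1) → 𝕜))) :
    Set (ℙ 𝕜 (Fin (n + 1) → 𝕜)) :=
  {p | ∀ (d : ℕ) (F : MvPolynomial (Fin (n + 1)) 𝕜), F.IsHomogeneous d →
    (∀ q ∈ S, MvPolynomial.eval q.rep F = 0) → MvPolynomial.eval p.rep F = 0}

/-- The projective closure of a subset of affine `n`-space. -/
def projectiveClosure (X : Set (Fin n → 𝕜)) : Set (ℙ 𝕜 (Fin (n + 1) → 𝕜)) :=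
  projectiveZariskiClosure (toProjective '' X)

/-- The hyperplane at infinity `x₀ = 0`. -/
def hyperplaneAtInfinity (𝕜 : Type*) [Field 𝕜] (n : ℕ) : Set (ℙ 𝕜 (Fin (n + 1) → 𝕜)) :=
  {p | p.rep 0 = 0}

/-- `X` and `Y` are disjoint at infinity if their projective closures have no common point on the
hyperplane at infinity. -/
def DisjointAtInfinity (X Y : Set (Fin n → 𝕜)) : Prop :=
  projectiveClosure X ∩ projectiveClosure Y ∩ hyperplaneAtInfinity 𝕜 n = ∅

end MinkowskiSum

/-! With `A`, `B` the coordinate rings of the two varieties, addition corresponds to `𝕜[z] → A ⊗ B`,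
`z ↦ x ⊗ 1 + 1 ⊗ y`. Its kernel is the ideal of the Minkowski sum (`ker_addComorphism`), so if the
map is integral, the sum has dimension `dim (A ⊗ B) = dim A + dim B` (`ringKrullDim_tensorProduct`).

Integrality (`finite_of_disjointAtInfinity`): filter `A ⊗ B` over `R = 𝕜[z]` by degree in `x`. As `x
+ y` comes from `R`, `y` acts as `-x` up to lower degree, so leading forms of equations of either
variety drop in degree. Their only possible common zero is `0`, since a nonzero one would be a
common point at infinity. By the Nullstellensatz, high powers of each `x_i` drop too, and the
filtration stops. -/

open scoped TensorProduct

/-! ### Krull dimension and tensor products over a field -/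

/-- An injective integral extension of commutative rings preserves the Krull dimension. -/
theorem RingHom.IsIntegral.ringKrullDim_eq {R S : Type*} [CommRing R] [CommRing S] (f : R →+* S)
    (hf : f.IsIntegral) (hinj : Function.Injective f) : ringKrullDim R = ringKrullDim S := by
  algebraize [f]
  apply le_antisymm
  · refine iSup_le fun l => ?_
    obtain ⟨⟨P, hP⟩, hPl⟩ := (algebraMap_isIntegral_iff.2 ‹_›).comap_surjective hinj
      (RelSeries.head l)
    have : P.LiesOver (RelSeries.head l).asIdeal := ⟨by rw [← hPl]; rfl⟩
    obtain ⟨L, hL, -⟩ := Ideal.exists_ltSeries_of_hasGoingUp l P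
    rw [← hL]
    exact Order.LTSeries.length_le_krullDim L
  · exact Order.krullDim_le_of_strictMono (PrimeSpectrum.comap (algebraMap R S))
      fun I J hIJ => Ideal.IsIntegral.comap_lt_comap (R := R) (I := I.asIdeal) (J := J.asIdeal) hIJ

theorem RingHom.IsIntegralElem.of_comp_eq {A B A' B' : Type*} [CommRing A] [CommRing B]
    [CommRing A'] [CommRing B'] {f : A →+* B} {g : A' →+* B'} (i : A →+* A') (j : B →+* B')
    (h : g.comp i = j.comp f) {x : B} (hx : f.IsIntegralElem x) : g.IsIntegralElem (j x) := by
  obtain ⟨p, hp, hpx⟩ := hx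
  refine ⟨p.map i, hp.map _, ?_⟩
  rw [Polynomial.eval₂_map, h, ← Polynomial.hom_eval₂, hpx, map_zero]

theorem Algebra.TensorProduct.map_isIntegral {k A B C D : Type*} [Field k] [CommRing A]
    [CommRing B] [CommRing C] [CommRing D] [Algebra k A] [Algebra k B] [Algebra k C] [Algebra k D]
    (f : A →ₐ[k] B) (g : C →ₐ[k] D) (hf : f.toRingHom.IsIntegral) (hg : g.toRingHom.IsIntegral) :
    (Algebra.TensorProduct.map f g).toRingHom.IsIntegral := by
  intro b
  induction b using TensorProduct.induction_on with
  | zero => exact RingHom.isIntegralElem_zero _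
  | add x y hx hy => exact RingHom.IsIntegralElem.add _ hx hy
  | tmul x y =>
    have h : x ⊗ₜ[k] y = (x ⊗ₜ[k] 1) * (1 ⊗ₜ[k] y) := by simp
    rw [h]
    apply RingHom.IsIntegralElem.mul
    · refine RingHom.IsIntegralElem.of_comp_eq
        (Algebra.TensorProduct.includeLeft (R := k) (S := k) (A := A) (B := C)).toRingHom
        (Algebra.TensorProduct.includeLeft (R := k) (S := k) (A := B) (B := D)).toRingHom
        (RingHom.ext fun a => ?_) (hf x)
      change Algebra.TensorProduct.map f g (a ⊗ₜ 1) = f a ⊗ₜ 1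
      simp
    · refine RingHom.IsIntegralElem.of_comp_eq
        (Algebra.TensorProduct.includeRight (R := k) (A := A) (B := C)).toRingHom
        (Algebra.TensorProduct.includeRight (R := k) (A := B) (B := D)).toRingHom
        (RingHom.ext fun a => ?_) (hg y)
      change Algebra.TensorProduct.map f g (1 ⊗ₜ a) = 1 ⊗ₜ g a
      simp

/-- The Krull dimension is additive on tensor products of finitely generated algebras over a
field. -/
theorem ringKrullDim_tensorProduct (k A B : Type*) [Field k] [CommRing A] [CommRing B]
    [Algebra k A] [Algebra k B] [Algebra.FiniteType k A] [Algebra.FiniteType k B] :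
    ringKrullDim (A ⊗[k] B) = ringKrullDim A + ringKrullDim B := by
  cases subsingleton_or_nontrivial A
  · have : Subsingleton (A ⊗[k] B) := inferInstance
    simp [ringKrullDim_eq_bot_of_subsingleton]
  cases subsingleton_or_nontrivial B
  · have : Subsingleton (A ⊗[k] B) := inferInstance
    simp [ringKrullDim_eq_bot_of_subsingleton]
  -- Noether normalization reduces to polynomial rings.
  obtain ⟨s, f, hf, hf'⟩ := exists_integral_inj_algHom_of_fg k A
  obtain ⟨r, g, hg, hg'⟩ := exists_integral_inj_algHom_of_fg k B
  have hfg : Function.Injective (Algebra.TensorProduct.map f g) :=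
    TensorProduct.map_injective_of_flat_flat f.toLinearMap g.toLinearMap hf hg
  rw [← RingHom.IsIntegral.ringKrullDim_eq _ (Algebra.TensorProduct.map_isIntegral f g hf' hg') hfg,
    ← RingHom.IsIntegral.ringKrullDim_eq _ hf' hf, ← RingHom.IsIntegral.ringKrullDim_eq _ hg' hg,
    ringKrullDim_eq_of_ringEquiv (MvPolynomial.tensorEquivSum k (Fin s) (Fin r) k).toRingEquiv]
  simp

/-- An element of `A ⊗ B` is zero if it is killed by enough algebra maps `A → k` and `B → k`. -/
theorem TensorProduct.eq_zero_of_forall_lift_eq_zero {k A B ι κ : Type*} [Field k] [CommRing A]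
    [CommRing B] [Algebra k A] [Algebra k B] (u : ι → A →ₐ[k] k) (v : κ → B →ₐ[k] k)
    (hu : ∀ a, (∀ i, u i a = 0) → a = 0) (hv : ∀ b, (∀ j, v j b = 0) → b = 0) (t : A ⊗[k] B)
    (ht : ∀ i j, Algebra.TensorProduct.lift (u i) (v j) (fun _ _ => Commute.all _ _) t = 0) :
    t = 0 := by
  -- `A ⊗ B` is free over `A` on a basis of `B`: the `u i` test the coefficients, which reassemble
  -- in `B` to be tested by the `v j`.
  let e := Module.Basis.ofVectorSpace k B
  let E := Algebra.TensorProduct.basis A e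
  have hcomm : ∀ i m (t : A ⊗[k] B), u i (E.repr t m) =
      e.repr (Algebra.TensorProduct.lift ((Algebra.ofId k B).comp (u i)) (AlgHom.id k B)
        (fun _ _ => Commute.all _ _) t) m := by
    intro i m t
    induction t using TensorProduct.induction_on with
    | zero => simp
    | add x y hx hy => simp [hx, hy]
    | tmul x y =>
      have h : algebraMap k B (u i x) * y = u i x • y :=
        (_root_.Algebra.smul_def _ _).symm
      simp [E, Algebra.ofId_apply, h]
  have hcomm' : ∀ i j (t : A ⊗[k] B), v j (Algebra.TensorProduct.lift
      ((Algebra.ofId k B).comp (u i)) (AlgHom.id k B) (fun _ _ => Commute.all _ _) t) =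
      Algebra.TensorProduct.lift (u i) (v j) (fun _ _ => Commute.all _ _) t := by
    intro i j t
    induction t using TensorProduct.induction_on with
    | zero => simp
    | add x y hx hy => simp [hx, hy]
    | tmul x y => simp [Algebra.ofId_apply]
  refine E.repr.injective (Finsupp.ext fun m => ?_)
  rw [map_zero, Finsupp.zero_apply]
  refine hu _ fun i => ?_
  rw [hcomm, hv _ fun j => (hcomm' i j t).trans (ht i j), map_zero, Finsupp.zero_apply]

namespace MinkowskiSum

open MvPolynomial

/-! ### The degree filtration -/

section DegreeFiltration

variable {𝕜 R B : Type*} [Field 𝕜] [CommRing R] [CommRing B] [Algebra R B]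
  [Algebra 𝕜 B] {n : ℕ}

variable (R) in
/-- The `R`-submodule of `B` spanned by the images under `φ` of the monomials of degree less
than `d`. -/
def degreeSpan (φ : MvPolynomial (Fin n) 𝕜 →ₐ[𝕜] B) (d : ℕ) : Submodule R B :=
  Submodule.span R ((fun s : Fin n →₀ ℕ => φ (monomial s 1)) '' {s | s.degree < d})

variable {φ ψ : MvPolynomial (Fin n) 𝕜 →ₐ[𝕜] B}

theorem degreeSpan_mono {d e : ℕ} (h : d ≤ e) : degreeSpan R φ d ≤ degreeSpan R φ e :=
  Submodule.span_mono (Set.image_mono fun _ hs => lt_of_lt_of_le hs h)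

theorem degreeSpan_fg (φ : MvPolynomial (Fin n) 𝕜 →ₐ[𝕜] B) (d : ℕ) : (degreeSpan R φ d).FG :=
  Submodule.fg_span ((Finsupp.finite_of_degree_lt d).image _)

variable [Algebra 𝕜 R] [IsScalarTower 𝕜 R B]

theorem smul_mem_degreeSpan (c : 𝕜) {b : B} {d : ℕ} (hb : b ∈ degreeSpan R φ d) :
    c • b ∈ degreeSpan R φ d := by
  rw [← algebraMap_smul R c b]
  exact Submodule.smul_mem _ _ hb

theorem map_monomial_eq_smul (χ : MvPolynomial (Fin n) 𝕜 →ₐ[𝕜] B) (s : Fin n →₀ ℕ) (c : 𝕜) :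
    χ (monomial s c) = c • χ (monomial s 1) := by
  rw [← map_smul, smul_monomial, smul_eq_mul, mul_one]

theorem map_mem_degreeSpan {f : MvPolynomial (Fin n) 𝕜} {d : ℕ}
    (hf : ∀ s ∈ f.support, s.degree < d) : φ f ∈ degreeSpan R φ d := by
  rw [f.as_sum, map_sum]
  refine Submodule.sum_mem _ fun s hs => ?_
  rw [map_monomial_eq_smul]
  exact smul_mem_degreeSpan _ (Submodule.subset_span ⟨s, hf s hs, rfl⟩)

theorem map_monomial_mul_mem_degreeSpan (s : Fin n →₀ ℕ) (c : 𝕜) {b : B} {d : ℕ}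
    (hb : b ∈ degreeSpan R φ d) : φ (monomial s c) * b ∈ degreeSpan R φ (s.degree + d) := by
  rw [map_monomial_eq_smul, smul_mul_assoc]
  refine smul_mem_degreeSpan _ ?_
  induction hb using Submodule.span_induction with
  | mem x hx =>
    obtain ⟨t, ht, rfl⟩ := hx
    simp only [← map_mul, monomial_mul, mul_one]
    refine Submodule.subset_span ⟨s + t, ?_, rfl⟩
    simpa using ht
  | zero => simp
  | add x y _ _ hx hy => rw [mul_add]; exact Submodule.add_mem _ hx hy
  | smul r x _ hx => rw [mul_smul_comm]; exact Submodule.smul_mem _ _ hx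

variable (R) in
/-- The ideal of polynomials all of whose homogeneous components have an image that is a
combination of monomials of smaller degree. -/
def lowerDegreeIdeal (φ : MvPolynomial (Fin n) 𝕜 →ₐ[𝕜] B) : Ideal (MvPolynomial (Fin n) 𝕜) where
  carrier := {f | ∀ d, φ (homogeneousComponent d f) ∈ degreeSpan R φ d}
  zero_mem' d := by simp
  add_mem' hf hg d := by
    rw [map_add, map_add]
    exact Submodule.add_mem _ (hf d) (hg d)
  smul_mem' a f hf d := by
    rw [smul_eq_mul, ← sum_homogeneousComponent f, Finset.mul_sum, map_sum, map_sum]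
    refine Submodule.sum_mem _ fun j _ => ?_
    rw [a.as_sum, Finset.sum_mul, map_sum, map_sum]
    refine Submodule.sum_mem _ fun s _ => ?_
    have hhom : (monomial s (coeff s a) * homogeneousComponent j f).IsHomogeneous (s.degree + j) :=
      (isHomogeneous_monomial _ rfl).mul (homogeneousComponent_isHomogeneous j f)
    rw [homogeneousComponent_of_mem hhom]
    split_ifs with h
    · rw [map_mul, h]
      exact map_monomial_mul_mem_degreeSpan _ _ (hf j)
    · simp

theorem mem_lowerDegreeIdeal_of_isHomogeneous {f : MvPolynomial (Fin n) 𝕜} {d : ℕ}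
    (hf : f.IsHomogeneous d) (h : φ f ∈ degreeSpan R φ d) : f ∈ lowerDegreeIdeal R φ := by
  intro e
  rw [homogeneousComponent_of_mem hf]
  split_ifs with he
  · rwa [← he] at h
  · simp

/-- By pigeonhole, a monomial of degree above `n * N` is divisible by some `X i ^ N`, which can be
rewritten in lower degree. -/
theorem degreeSpan_le_of_pow_mem {N : ℕ}
    (hN : ∀ i, (X i : MvPolynomial (Fin n) 𝕜) ^ N ∈ lowerDegreeIdeal R φ) (d : ℕ) :
    degreeSpan R φ d ≤ degreeSpan R φ (n * N + 1) := by
  induction d with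
  | zero => exact degreeSpan_mono (Nat.zero_le _)
  | succ d ih =>
    by_cases hd : d ≤ n * N
    · exact degreeSpan_mono (by omega)
    refine Submodule.span_le.2 ?_
    rintro _ ⟨s, hs, rfl⟩
    refine ih ?_
    obtain hs' | hs' := Nat.lt_succ_iff_lt_or_eq.1 hs
    · exact Submodule.subset_span ⟨s, hs', rfl⟩
    obtain ⟨i, hi⟩ : ∃ i, N ≤ s i := by
      by_contra! hcon
      have h1 : s.degree ≤ ∑ _i : Fin n, N := by
        rw [Finsupp.degree_eq_sum]
        exact Finset.sum_le_sum fun i _ => (hcon i).le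
      simp at h1
      omega
    have hle : Finsupp.single i N ≤ s := Finsupp.single_le_iff.2 hi
    have hdeg : (s - Finsupp.single i N).degree + N = d := by
      rw [← hs', ← tsub_add_cancel_of_le hle]
      simp
    have hpow := hN i N
    rw [homogeneousComponent_eq_self (isHomogeneous_X_pow i N)] at hpow
    have := map_monomial_mul_mem_degreeSpan (s - Finsupp.single i N) 1 hpow
    rw [hdeg, X_pow_eq_monomial, ← map_mul, monomial_mul, tsub_add_cancel_of_le hle, mul_one] at this
    exact this

/-- If `ψ` and `-φ` agree on the variables up to constants from `R`, then on monomials they agree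
up to terms of lower degree. -/
theorem map_monomial_sub_mem_degreeSpan
    (hsum : ∀ i, φ (X i) + ψ (X i) ∈ Set.range (algebraMap R B)) (s : Fin n →₀ ℕ) :
    ψ (monomial s 1) - (-1) ^ s.degree * φ (monomial s 1) ∈ degreeSpan R φ s.degree := by
  obtain ⟨d, hd⟩ : ∃ d, s.degree = d := ⟨_, rfl⟩
  induction d generalizing s with
  | zero =>
    obtain rfl : s = 0 := by simpa [Finsupp.degree_eq_zero_iff] using hd
    have h1 : (monomial (0 : Fin n →₀ ℕ) (1 : 𝕜)) = 1 := rfl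
    simp [h1]
  | succ d ih =>
    obtain ⟨i, hi⟩ : ∃ i, s i ≠ 0 := by
      by_contra! hcon
      obtain rfl : s = 0 := Finsupp.ext hcon
      simp at hd
    have hle : Finsupp.single i 1 ≤ s := Finsupp.single_le_iff.2 (Nat.one_le_iff_ne_zero.2 hi)
    obtain ⟨t, rfl⟩ := exists_add_of_le hle
    have ht : t.degree = d := by
      rw [map_add, Finsupp.degree_single] at hd
      omega
    have hmon : monomial (Finsupp.single i 1 + t) (1 : 𝕜) = X i * monomial t 1 := by
      rw [X, monomial_mul, mul_one]
    obtain ⟨r, hr⟩ := hsum i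
    have hv := ih t ht
    have hXv := map_monomial_mul_mem_degreeSpan (Finsupp.single i 1) 1 hv
    have hmem : φ (monomial t 1) ∈ degreeSpan R φ (d + 1) :=
      Submodule.subset_span ⟨t, by simp [ht], rfl⟩
    have hψ : ψ (X i) = algebraMap R B r - φ (X i) := by rw [hr]; ring
    rw [Finsupp.degree_single, ht, add_comm 1 d] at hXv
    rw [ht] at hv
    rw [hd, hmon, map_mul, map_mul, hψ]
    have key : (algebraMap R B r - φ (X i)) * ψ (monomial t 1) -
        (-1) ^ (d + 1) * (φ (X i) * φ (monomial t 1)) =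
        r • (ψ (monomial t 1) - (-1) ^ d * φ (monomial t 1)) +
        ((-1) ^ d * r) • φ (monomial t 1) -
        φ (monomial (Finsupp.single i 1) 1) * (ψ (monomial t 1) - (-1) ^ d * φ (monomial t 1)) := by
      rw [Algebra.smul_def, Algebra.smul_def, map_mul (algebraMap R B), map_pow (algebraMap R B),
        map_neg (algebraMap R B), map_one (algebraMap R B),
        show monomial (Finsupp.single i 1) (1 : 𝕜) = X i from rfl]
      ring
    rw [key]
    exact Submodule.sub_mem _ (Submodule.add_mem _
      (Submodule.smul_mem _ _ (degreeSpan_mono (Nat.le_succ d) hv)) (Submodule.smul_mem _ _ hmem)) hXv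

theorem map_sub_mem_degreeSpan_of_isHomogeneous
    (hsum : ∀ i, φ (X i) + ψ (X i) ∈ Set.range (algebraMap R B)) {f : MvPolynomial (Fin n) 𝕜}
    {d : ℕ} (hf : f.IsHomogeneous d) : ψ f - (-1) ^ d * φ f ∈ degreeSpan R φ d := by
  rw [f.as_sum, map_sum, map_sum, Finset.mul_sum, ← Finset.sum_sub_distrib]
  refine Submodule.sum_mem _ fun s hs => ?_
  obtain rfl := hf.degree_eq_sum_deg_support hs
  rw [map_monomial_eq_smul φ, map_monomial_eq_smul ψ, mul_smul_comm, ← smul_sub]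
  exact smul_mem_degreeSpan _ (map_monomial_sub_mem_degreeSpan hsum s)

theorem map_mem_degreeSpan_of_add_mem_range
    (hsum : ∀ i, φ (X i) + ψ (X i) ∈ Set.range (algebraMap R B)) {f : MvPolynomial (Fin n) 𝕜}
    {d : ℕ} (hf : ∀ s ∈ f.support, s.degree < d) : ψ f ∈ degreeSpan R φ d := by
  rw [f.as_sum, map_sum]
  refine Submodule.sum_mem _ fun s hs => ?_
  rw [map_monomial_eq_smul]
  refine smul_mem_degreeSpan _ ?_
  have h1 := degreeSpan_mono (hf s hs).le (map_monomial_sub_mem_degreeSpan hsum s)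
  have h2 : ((-1 : R) ^ s.degree) • φ (monomial s 1) ∈ degreeSpan R φ d :=
    Submodule.smul_mem _ _ (Submodule.subset_span ⟨s, hf s hs, rfl⟩)
  rw [Algebra.smul_def, map_pow, map_neg, map_one] at h2
  simpa using Submodule.add_mem _ h1 h2

end DegreeFiltration

/-! ### Leading forms and points at infinity -/

section Dehomogenization

variable {𝕜 : Type*} [Field 𝕜] {n : ℕ}

/-- Substitute the constant `c` for the homogenizing variable. -/
noncomputable def specializeZero (c : 𝕜) :
    MvPolynomial (Fin (n + 1)) 𝕜 →ₐ[𝕜] MvPolynomial (Fin n) 𝕜 :=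
  aeval (Fin.cons (C c) X)

theorem eval_specializeZero (c : 𝕜) (F : MvPolynomial (Fin (n + 1)) 𝕜) (x : Fin n → 𝕜) :
    aeval x (specializeZero c F) = eval (Fin.cons c x) F := by
  rw [← coe_aeval_eq_eval, RingHom.coe_coe, specializeZero, ← AlgHom.comp_apply]
  congr 1
  ext i
  refine Fin.cases ?_ (fun j => ?_) i <;> simp

theorem specializeZero_zero_isHomogeneous {F : MvPolynomial (Fin (n + 1)) 𝕜} {d : ℕ}
    (hF : F.IsHomogeneous d) : (specializeZero 0 F).IsHomogeneous d := by
  have := hF.aeval (S := 𝕜) (Fin.cons (C 0) X : Fin (n + 1) → MvPolynomial (Fin n) 𝕜) (n := 1) (by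
    refine Fin.cases ?_ fun j => ?_
    · simpa using isHomogeneous_zero _ _ 1
    · simpa using isHomogeneous_X 𝕜 j)
  rwa [one_mul] at this

theorem specializeZero_monomial (c a : 𝕜) (s : Fin (n + 1) →₀ ℕ) :
    specializeZero c (monomial s a) = monomial s.tail (a * c ^ s 0) := by
  rw [specializeZero, aeval_monomial, Finsupp.prod_fintype _ _ (by simp), Fin.prod_univ_succ,
    monomial_eq, Finsupp.prod_fintype _ _ (by simp)]
  simp [mul_assoc, algebraMap_eq, Finsupp.tail_apply]

/-- Setting `x₀ = 0` keeps exactly the monomials free of `x₀`; the others lose degree when `x₀ = 1`.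
-/
theorem degree_lt_of_mem_support_specializeZero_sub {F : MvPolynomial (Fin (n + 1)) 𝕜} {d : ℕ}
    (hF : F.IsHomogeneous d) :
    ∀ s ∈ (specializeZero 1 F - specializeZero 0 F).support, s.degree < d := by
  suffices h : specializeZero 1 F - specializeZero 0 F ∈
      restrictSupport 𝕜 {s : Fin n →₀ ℕ | s.degree < d} from
    fun s hs => (mem_restrictSupport_iff _).1 h hs
  rw [F.as_sum, map_sum, map_sum, ← Finset.sum_sub_distrib]
  refine Submodule.sum_mem _ fun s hs => ?_
  have hdeg := hF.degree_eq_sum_deg_support hs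
  rw [specializeZero_monomial, specializeZero_monomial]
  by_cases h0 : s 0 = 0
  · simp [h0]
  · rw [zero_pow h0, mul_zero, monomial_zero, sub_zero, mem_restrictSupport_iff]
    intro t ht
    obtain rfl : t = s.tail := by simpa using support_monomial_subset ht
    have : d = s 0 + s.tail.degree := by
      rw [hdeg, ← Finsupp.degree_apply, Finsupp.degree_eq_sum, Finsupp.degree_eq_sum,
        Fin.sum_univ_succ]
      simp [Finsupp.tail_apply]
    change s.tail.degree < d
    omega

theorem eval_smul_eq_zero_iff {m d : ℕ} {F : MvPolynomial (Fin m) 𝕜} (hF : F.IsHomogeneous d)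
    (a : 𝕜ˣ) (v : Fin m → 𝕜) : eval (a • v) F = 0 ↔ eval v F = 0 := by
  have : eval (a • v) F = (a : 𝕜) ^ d * eval v F := by
    rw [eval_eq', eval_eq', Finset.mul_sum]
    refine Finset.sum_congr rfl fun s hs => ?_
    rw [hF.degree_eq_sum_deg_support hs, ← Finsupp.degree_apply, Finsupp.degree_eq_sum,
      ← Finset.prod_pow_eq_pow_sum]
    simp only [Pi.smul_apply, Units.smul_def, smul_eq_mul, mul_pow, Finset.prod_mul_distrib]
    ring
  simp [this]

theorem mk_cons_zero_mem_projectiveClosure {S : Set (Fin n → 𝕜)} {a : Fin n → 𝕜}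
    (ha : (Fin.cons 0 a : Fin (n + 1) → 𝕜) ≠ 0)
    (h : ∀ (d : ℕ) (F : MvPolynomial (Fin (n + 1)) 𝕜), F.IsHomogeneous d →
      specializeZero 1 F ∈ vanishingIdeal 𝕜 S → aeval a (specializeZero 0 F) = 0) :
    Projectivization.mk 𝕜 _ ha ∈ projectiveClosure S := by
  intro d F hF hS
  obtain ⟨c, hc⟩ := Projectivization.exists_smul_eq_mk_rep 𝕜 _ ha
  rw [← hc, eval_smul_eq_zero_iff hF, ← eval_specializeZero]
  refine h d F hF fun x hx => ?_
  have := hS _ ⟨x, hx, rfl⟩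
  obtain ⟨c, hc⟩ := Projectivization.exists_smul_eq_mk_rep 𝕜 _ (cons_one_ne_zero x)
  rw [toProjective, ← hc, eval_smul_eq_zero_iff hF] at this
  rw [eval_specializeZero, this]

theorem mk_cons_zero_mem_hyperplaneAtInfinity {a : Fin n → 𝕜}
    (ha : (Fin.cons 0 a : Fin (n + 1) → 𝕜) ≠ 0) :
    Projectivization.mk 𝕜 _ ha ∈ hyperplaneAtInfinity 𝕜 n := by
  obtain ⟨c, hc⟩ := Projectivization.exists_smul_eq_mk_rep 𝕜 _ ha
  change (Projectivization.mk 𝕜 _ ha).rep 0 = 0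
  rw [← hc]
  simp

end Dehomogenization

/-! ### Finiteness from disjointness at infinity -/

section Finiteness

variable {𝕜 R B : Type*} [Field 𝕜] [CommRing R] [CommRing B] [Algebra 𝕜 R] [Algebra R B]
  [Algebra 𝕜 B] [IsScalarTower 𝕜 R B] {n : ℕ} {S T : Set (Fin n → 𝕜)}
  {φ ψ : MvPolynomial (Fin n) 𝕜 →ₐ[𝕜] B}

/-- A nonzero zero `a` would put `[0 : a]` in both projective closures, because the ideal contains
the leading forms coming from `S` and from `T`. -/
theorem zeroLocus_lowerDegreeIdeal_subset (hST : DisjointAtInfinity S T)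
    (hsum : ∀ i, φ (X i) + ψ (X i) ∈ Set.range (algebraMap R B))
    (hφ : ∀ f ∈ vanishingIdeal 𝕜 S, φ f = 0) (hψ : ∀ f ∈ vanishingIdeal 𝕜 T, ψ f = 0) :
    zeroLocus 𝕜 (lowerDegreeIdeal R φ) ⊆ {0} := by
  intro a ha
  by_contra hne
  have hcons : (Fin.cons 0 a : Fin (n + 1) → 𝕜) ≠ 0 := fun h =>
    hne (funext fun i => by simpa using congrFun h i.succ)
  refine Set.eq_empty_iff_forall_notMem.1 hST (Projectivization.mk 𝕜 _ hcons)
    ⟨⟨mk_cons_zero_mem_projectiveClosure hcons fun d F hF hS => ha _ ?_,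
      mk_cons_zero_mem_projectiveClosure hcons fun d F hF hT => ha _ ?_⟩,
      mk_cons_zero_mem_hyperplaneAtInfinity hcons⟩
  · have hlow : φ (specializeZero 1 F - specializeZero 0 F) ∈ degreeSpan R φ d :=
      map_mem_degreeSpan (degree_lt_of_mem_support_specializeZero_sub hF)
    rw [map_sub, hφ _ hS, zero_sub, Submodule.neg_mem_iff] at hlow
    exact mem_lowerDegreeIdeal_of_isHomogeneous (specializeZero_zero_isHomogeneous hF) hlow
  · have hlow : ψ (specializeZero 1 F - specializeZero 0 F) ∈ degreeSpan R φ d :=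
      map_mem_degreeSpan_of_add_mem_range hsum (degree_lt_of_mem_support_specializeZero_sub hF)
    rw [map_sub, hψ _ hT, zero_sub, Submodule.neg_mem_iff] at hlow
    have hhom := specializeZero_zero_isHomogeneous hF
    have hsub := Submodule.sub_mem _ hlow (map_sub_mem_degreeSpan_of_isHomogeneous hsum hhom)
    rw [sub_sub_cancel] at hsub
    -- Passing from `ψ` to `φ` costs only the sign `(-1) ^ d` on forms of degree `d`.
    have := Submodule.smul_mem _ ((-1 : R) ^ d) hsub
    rw [Algebra.smul_def, map_pow, map_neg, map_one, ← mul_assoc, ← mul_pow, neg_one_mul, neg_neg,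
      one_pow, one_mul] at this
    exact mem_lowerDegreeIdeal_of_isHomogeneous hhom this

variable [IsAlgClosed 𝕜]

theorem exists_forall_X_pow_mem_lowerDegreeIdeal
    (h : zeroLocus 𝕜 (lowerDegreeIdeal R φ) ⊆ {0}) :
    ∃ N, ∀ i, (X i : MvPolynomial (Fin n) 𝕜) ^ N ∈ lowerDegreeIdeal R φ := by
  have hrad : ∀ i, (X i : MvPolynomial (Fin n) 𝕜) ∈ (lowerDegreeIdeal R φ).radical := by
    intro i
    rw [← vanishingIdeal_zeroLocus_eq_radical (K := 𝕜)]
    intro a ha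
    rw [h ha]
    simp
  choose N hN using hrad
  exact ⟨∑ i, N i, fun i => Ideal.pow_mem_of_pow_mem _ (hN i)
    (Finset.single_le_sum (fun _ _ => Nat.zero_le _) (Finset.mem_univ i))⟩

/-- If `S` and `T` are disjoint at infinity, then a ring generated by a point of `S` and a point of
`T` is finite over any subring containing the sum of the two points. -/
theorem finite_of_disjointAtInfinity (hST : DisjointAtInfinity S T)
    (hsum : ∀ i, φ (X i) + ψ (X i) ∈ Set.range (algebraMap R B))
    (hφ : ∀ f ∈ vanishingIdeal 𝕜 S, φ f = 0) (hψ : ∀ f ∈ vanishingIdeal 𝕜 T, ψ f = 0)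
    (hgen : ∀ b, b ∈ Submodule.span R {b | ∃ p q, φ p * ψ q = b}) : Module.Finite R B := by
  obtain ⟨N, hN⟩ := exists_forall_X_pow_mem_lowerDegreeIdeal
    (zeroLocus_lowerDegreeIdeal_subset hST hsum hφ hψ)
  refine ⟨?_⟩
  suffices h : (⊤ : Submodule R B) = degreeSpan R φ (n * N + 1) from h ▸ degreeSpan_fg φ _
  refine (eq_top_iff.2 fun b _ => ?_).symm
  refine Submodule.span_le.2 ?_ (hgen b)
  rintro _ ⟨p, q, rfl⟩
  have hq : ψ q ∈ degreeSpan R φ (q.totalDegree + 1) :=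
    map_mem_degreeSpan_of_add_mem_range hsum fun s hs =>
      Nat.lt_succ_of_le (le_totalDegree hs)
  rw [p.as_sum, map_sum, Finset.sum_mul]
  exact Submodule.sum_mem _ fun s _ =>
    degreeSpan_le_of_pow_mem hN _ (map_monomial_mul_mem_degreeSpan s _ hq)

end Finiteness

end MinkowskiSum

/-! ### The comorphism of addition -/

namespace MinkowskiSum

open MvPolynomial

variable {𝕜 : Type*} [Field 𝕜] {n : ℕ}

/-- Evaluation of a regular function on `S` at a point of `S`. -/
noncomputable def evalAt (S : Set (Fin n → 𝕜)) (x : S) : CoordinateRing S →ₐ[𝕜] 𝕜 :=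
  Ideal.Quotient.liftₐ _ (aeval (x : Fin n → 𝕜)) fun _ hf => hf x x.2

theorem evalAt_mk (S : Set (Fin n → 𝕜)) (x : S) (f : MvPolynomial (Fin n) 𝕜) :
    evalAt S x (Ideal.Quotient.mkₐ 𝕜 _ f) = aeval (x : Fin n → 𝕜) f :=
  rfl

theorem eq_zero_of_forall_evalAt_eq_zero (S : Set (Fin n → 𝕜)) (a : CoordinateRing S)
    (h : ∀ x, evalAt S x a = 0) : a = 0 := by
  obtain ⟨f, rfl⟩ := Ideal.Quotient.mk_surjective a
  exact Ideal.Quotient.eq_zero_iff_mem.2 fun x hx => h ⟨x, hx⟩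

theorem vanishingIdeal_zariskiClosure (S : Set (Fin n → 𝕜)) :
    vanishingIdeal 𝕜 (zariskiClosure S) = vanishingIdeal 𝕜 S :=
  le_antisymm (vanishingIdeal_anti_mono (zeroLocus_vanishingIdeal_le S))
    (le_vanishingIdeal_zeroLocus _)

section AddComorphism

variable {A B : Type*} [CommRing A] [CommRing B] [Algebra 𝕜 A] [Algebra 𝕜 B]

/-- The comorphism `f ↦ f(x ⊗ 1 + 1 ⊗ y)` of the sum of an `A`-valued point `x` and a `B`-valued
point `y` of affine space. -/
noncomputable def addComorphism (φ : MvPolynomial (Fin n) 𝕜 →ₐ[𝕜] A)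
    (ψ : MvPolynomial (Fin n) 𝕜 →ₐ[𝕜] B) : MvPolynomial (Fin n) 𝕜 →ₐ[𝕜] A ⊗[𝕜] B :=
  aeval fun i => φ (X i) ⊗ₜ[𝕜] 1 + 1 ⊗ₜ[𝕜] ψ (X i)

variable {φ : MvPolynomial (Fin n) 𝕜 →ₐ[𝕜] A} {ψ : MvPolynomial (Fin n) 𝕜 →ₐ[𝕜] B}

theorem lift_addComorphism (u : A →ₐ[𝕜] 𝕜) (v : B →ₐ[𝕜] 𝕜) {x y : Fin n → 𝕜}
    (hu : u.comp φ = aeval x) (hv : v.comp ψ = aeval y) (f : MvPolynomial (Fin n) 𝕜) :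
    Algebra.TensorProduct.lift u v (fun _ _ => Commute.all _ _) (addComorphism φ ψ f) =
      aeval (x + y) f := by
  rw [← AlgHom.comp_apply]
  congr 1
  refine MvPolynomial.algHom_ext fun i => ?_
  have hx : u (φ (X i)) = x i := by rw [← AlgHom.comp_apply, hu, aeval_X]
  have hy : v (ψ (X i)) = y i := by rw [← AlgHom.comp_apply, hv, aeval_X]
  simp [addComorphism, hx, hy]

/-- The addition map is finite if `S` and `T` are disjoint at infinity. -/
theorem addComorphism_isIntegral [IsAlgClosed 𝕜] {S T : Set (Fin n → 𝕜)}
    (hST : DisjointAtInfinity S T) (hφ : Function.Surjective φ) (hψ : Function.Surjective ψ)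
    (hS : ∀ f ∈ vanishingIdeal 𝕜 S, φ f = 0) (hT : ∀ f ∈ vanishingIdeal 𝕜 T, ψ f = 0) :
    (addComorphism φ ψ).toRingHom.IsIntegral := by
  algebraize [(addComorphism φ ψ).toRingHom]
  have : IsScalarTower 𝕜 (MvPolynomial (Fin n) 𝕜) (A ⊗[𝕜] B) :=
    IsScalarTower.of_algebraMap_eq fun c => ((addComorphism φ ψ).commutes c).symm
  have hfin : Module.Finite (MvPolynomial (Fin n) 𝕜) (A ⊗[𝕜] B) := by
    refine finite_of_disjointAtInfinity hST (φ := Algebra.TensorProduct.includeLeft.comp φ)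
      (ψ := Algebra.TensorProduct.includeRight.comp ψ)
      (fun i => ⟨X i, aeval_X _ i⟩) (fun f hf => ?_) (fun f hf => ?_) (fun b => ?_)
    · rw [AlgHom.comp_apply, hS f hf, map_zero]
    · rw [AlgHom.comp_apply, hT f hf, map_zero]
    · induction b using TensorProduct.induction_on with
      | zero => exact Submodule.zero_mem _
      | add x y hx hy => exact Submodule.add_mem _ hx hy
      | tmul x y =>
        obtain ⟨p, rfl⟩ := hφ x
        obtain ⟨q, rfl⟩ := hψ y
        exact Submodule.subset_span ⟨p, q, by simp⟩
  exact algebraMap_isIntegral_iff.2 inferInstance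

end AddComorphism

/-- Pairs of points of `S` and `T` separate elements of the tensor product, and at `(x, y)` the
image of `f` takes the value `f (x + y)`. -/
theorem ker_addComorphism (S T : Set (Fin n → 𝕜)) :
    RingHom.ker (addComorphism (Ideal.Quotient.mkₐ 𝕜 (vanishingIdeal 𝕜 S))
      (Ideal.Quotient.mkₐ 𝕜 (vanishingIdeal 𝕜 T))).toRingHom =
      vanishingIdeal 𝕜 (minkowskiSum S T) := by
  have hlift := fun (x : S) (y : T) => lift_addComorphism (evalAt S x) (evalAt T y)
    (φ := Ideal.Quotient.mkₐ 𝕜 _) (ψ := Ideal.Quotient.mkₐ 𝕜 _)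
    (AlgHom.ext (evalAt_mk S x)) (AlgHom.ext (evalAt_mk T y))
  rw [minkowskiSum, vanishingIdeal_zariskiClosure]
  ext f
  constructor
  · rintro hf _ ⟨⟨x, y⟩, ⟨hx, hy⟩, rfl⟩
    refine (hlift ⟨x, hx⟩ ⟨y, hy⟩ f).symm.trans ?_
    exact (congrArg _ hf).trans (map_zero _)
  · intro hf
    refine TensorProduct.eq_zero_of_forall_lift_eq_zero (evalAt S) (evalAt T)
      (eq_zero_of_forall_evalAt_eq_zero S) (eq_zero_of_forall_evalAt_eq_zero T) _ fun x y => ?_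
    exact (hlift x y f).trans (hf _ ⟨(x, y), ⟨x.2, y.2⟩, rfl⟩)

theorem dim_minkowskiSum [IsAlgClosed 𝕜] {S T : Set (Fin n → 𝕜)} (hST : DisjointAtInfinity S T) :
    dim (minkowskiSum S T) = dim S + dim T := by
  have hint := addComorphism_isIntegral hST
    (Ideal.Quotient.mkₐ_surjective 𝕜 (vanishingIdeal 𝕜 S))
    (Ideal.Quotient.mkₐ_surjective 𝕜 (vanishingIdeal 𝕜 T))
    (fun _ hf => Ideal.Quotient.eq_zero_iff_mem.2 hf)
    (fun _ hf => Ideal.Quotient.eq_zero_iff_mem.2 hf)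
  unfold dim
  rw [← ringKrullDim_tensorProduct 𝕜]
  unfold CoordinateRing
  rw [← ker_addComorphism]
  -- Modulo its kernel the comorphism is injective and remains integral.
  refine RingHom.IsIntegral.ringKrullDim_eq _ ?_ (RingHom.kerLift_injective _)
  exact RingHom.IsIntegral.tower_top (Ideal.Quotient.mk _) _ hint

end MinkowskiSum

theorem theorem3p10 {𝕜 : Type*} [Field 𝕜] [IsAlgClosed 𝕜] (h2 : ringChar 𝕜 ≠ 2) {n : ℕ}
    (X Y : Set (Fin n → 𝕜))
    (hX : MinkowskiSum.IsAffineVariety X) (hY : MinkowskiSum.IsAffineVariety Y)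
    (hXY : MinkowskiSum.DisjointAtInfinity X Y) :
    MinkowskiSum.dim (MinkowskiSum.minkowskiSum X Y) =
      MinkowskiSum.dim X + MinkowskiSum.dim Y := by
  exact MinkowskiSum.dim_minkowskiSum hXY
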